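/- **Network.** A base station is located at the origin of $\mathbb R^2$; its cell is the disk of radius $R>0$ around it. The locations $x_k$ of the D2D transmitters form a homogeneous Poisson point process $\Phi$ on $\mathbb R^2$ with density $\lambda>0$; let $K$ be the number of them in the cell, so $\mathbb E[K]=\lambda\pi R^2$. The D2D transmit powers $p_k\ge 0$ are i.i.d. with $\mathbb E[p_k^{2/\alpha}]<\infty$, the fading coefficients $h_{0,k}$ (from D2D transmitter $k$ to the base station) and $h_{0,0}$ (from the uplink user to the base station) are i.i.d. $\mathcal{CN}(0,1)$, and locations, D2D powers and fading coefficients are mutually independent. The path-loss exponent is $\alpha>2$, there is no noise ($\sigma^2=0$), and the uplink user is at a fixed distance $d>0$ from the base station. If the uplink user transmits with power $q\geq 0$, then $$\mathrm{SINR}_0(q)=\frac{q\,|h_{0,0}|^2d^{-\alpha}}{\sum_{k\in\Phi}p_k|h_{0,k}|^2\|x_k\|^{-\alpha}}$$ (with $a/0=\infty$ for $a>0$ and $0/0=0$). For a target $\beta_0>0$ put $\phi(q)=\mathbb P(\mathrm{SINR}_0(q)\ge\beta_0)$. **Uplink power control.** Let $0<P_{\mathrm{avg},c}\le P_{\max,c}$.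 The uplink power $p_0$ is random and independent of everything above. Its law is called optimal if it maximizes $\int\phi\,\mathrm d\nu$ among all probability measures $\nu$ on $[0,P_{\max,c}]$ with mean $P_{\mathrm{avg},c}$. The cellular coverage probability at distance $d$ is $\bar P^{(C)}_{\mathrm{cov}}(d;\beta_0)=\mathbb P(\mathrm{SINR}_0(p_0)\ge\beta_0)$. With $\operatorname{sinc}(x)=\frac{\sin \pi x}{\pi x}$, put $$\tilde p_0(d)=\left(\frac{2\,\mathbb E[p_k^{2/\alpha}]}{\alpha\operatorname{sinc}(2/\alpha)}\right)^{\alpha/2}\mathbb E[K]^{\alpha/2}\,\beta_0\left(\frac dR\right)^{\alpha},\qquad p_0^\star(d)=\max\{\min\{\tilde p_0(d),P_{\max,c}\},P_{\mathrm{avg},c}\}.$$ **Claim.** The on-off law ($p_0=p_0^\star(d)$ with probability $P_{\mathrm{avg},c}/p_0^\star(d)$, and $p_0=0$ otherwise) is optimal. Under this optimal on-off power control, and under any other optimal law of $p_0$, $$\bar P^{(C)}_{\mathrm{cov}}(d;\beta_0)=\begin{cases}\dfrac{P_{\mathrm{avg},c}}{P_{\max,c}}\exp\left\{-\dfrac{\mathbb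 E[K]\beta_0^{2/\alpha}}{\operatorname{sinc}(2/\alpha)}\mathbb E[p_k^{2/\alpha}]\left(\dfrac dR\right)^2P_{\max,c}^{-2/\alpha}\right\}, & \tilde p_0(d)\ge P_{\max,c},\\[3ex] \dfrac{P_{\mathrm{avg},c}\,\exp(-\alpha/2)}{\left(\frac{2\mathbb E[p_k^{2/\alpha}]}{\alpha\operatorname{sinc}(2/\alpha)}\right)^{\alpha/2}\mathbb E[K]^{\alpha/2}\beta_0\left(\frac dR\right)^\alpha}, & P_{\mathrm{avg},c}<\tilde p_0(d)<P_{\max,c},\\[3ex] \exp\left\{-\dfrac{\mathbb E[K]\beta_0^{2/\alpha}}{\operatorname{sinc}(2/\alpha)}\mathbb E[p_k^{2/\alpha}]\left(\dfrac dR\right)^2P_{\mathrm{avg},c}^{-2/\alpha}\right\}, & \tilde p_0(d)\le P_{\mathrm{avg},c}.\end{cases}$$ -/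

import Mathlib

open MeasureTheory ProbabilityTheory
open scoped ENNReal NNReal

noncomputable section

namespace D2D

/-- The Euclidean plane; the base station sits at the origin. -/
abbrev Plane : Type := EuclideanSpace ℝ (Fin 2)

/-- Number of points (with multiplicity) of the random sequence `X` lying in `B`. -/
def pointCount {Ω : Type*} (X : ℕ → Ω → Plane) (B : Set Plane) (ω : Ω) : ℝ≥0∞ :=
  ∑' k, B.indicator (fun _ => (1 : ℝ≥0∞)) (X k ω)

/-- The points `X 0, X 1, …` enumerate a homogeneous Poisson point process of density `lam` on the
plane: counts of Borel sets of finite area are Poisson with mean `lam * area`, and counts of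
pairwise disjoint Borel sets are independent. -/
structure IsPoissonPointProcess {Ω : Type*} [MeasurableSpace Ω] (P : Measure Ω) (lam : ℝ)
    (X : ℕ → Ω → Plane) : Prop where
  measurable : ∀ k, Measurable (X k)
  poisson : ∀ B : Set Plane, MeasurableSet B → volume B ≠ ∞ →
    P.map (pointCount X B) =
      (poissonMeasure (Real.toNNReal (lam * (volume B).toReal))).map (fun n : ℕ => (n : ℝ≥0∞))
  indep : ∀ (n : ℕ) (B : Fin n → Set Plane), (∀ i, MeasurableSet (B i)) →
    Pairwise (fun i j => Disjoint (B i) (B j)) →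
    iIndepFun (fun i => pointCount X (B i)) P

/-- The circularly symmetric complex Gaussian law `CN(0,1)`: independent real and imaginary parts,
each centred normal with variance `1/2`. -/
def stdComplexNormal : Measure ℂ :=
  ((gaussianReal 0 (1 / 2)).prod (gaussianReal 0 (1 / 2))).map (fun z : ℝ × ℝ => ⟨z.1, z.2⟩)

/-- The random ingredients of the uplink, other than the uplink transmit power: D2D transmitter
locations `X k`, D2D transmit powers `p k` (i.i.d. with law `F`), fading `h k` from D2D
transmitter `k` to the base station, and fading `h₀` of the uplink user. All are independent. -/
structure IsUplinkNetwork {Ω : Type*} [MeasurableSpace Ω] (P : Measure Ω) (lam : ℝ)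
    (F : Measure ℝ) (X : ℕ → Ω → Plane) (p : ℕ → Ω → ℝ) (h : ℕ → Ω → ℂ) (h₀ : Ω → ℂ) : Prop where
  ppp : IsPoissonPointProcess P lam X
  measurable_power : ∀ k, Measurable (p k)
  law_power : ∀ k, P.map (p k) = F
  iIndep_power : iIndepFun p P
  measurable_fading : ∀ k, Measurable (h k)
  law_fading : ∀ k, P.map (h k) = stdComplexNormal
  iIndep_fading : iIndepFun h P
  measurable_uplink : Measurable h₀
  law_uplink : P.map h₀ = stdComplexNormal
  indep_loc_power : IndepFun (fun ω k => X k ω) (fun ω k => p k ω) P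
  indep_fading : IndepFun (fun ω => ((fun k => X k ω), (fun k => p k ω))) (fun ω k => h k ω) P
  indep_uplink :
    IndepFun (fun ω => ((fun k => X k ω), (fun k => p k ω), (fun k => h k ω))) h₀ P

/-- Uplink SINR at the base station, as an extended nonnegative number (`a / 0 = ∞` for `a > 0`,
`0 / 0 = 0`): path-loss exponent `α`, noise variance `σ2`, user distance `d`, uplink transmit power
`q`, uplink fading `g₀`; interferers at `x k` with power `s k` and fading `g k`. -/
def sinr (α σ2 d q : ℝ) (g₀ : ℂ) (x : ℕ → Plane) (s : ℕ → ℝ) (g : ℕ → ℂ) : ℝ≥0∞ :=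
  (ENNReal.ofReal q * ‖g₀‖ₑ ^ 2 * ENNReal.ofReal d ^ (-α)) /
    ((∑' k, ENNReal.ofReal (s k) * ‖g k‖ₑ ^ 2 * ‖x k‖ₑ ^ (-α)) + ENNReal.ofReal σ2)

/-- Probability that the SINR is at least `β₀` when the (possibly random) uplink transmit power
is `q`. -/
def coverage {Ω : Type*} [MeasurableSpace Ω] (P : Measure Ω) (X : ℕ → Ω → Plane) (p : ℕ → Ω → ℝ)
    (h : ℕ → Ω → ℂ) (h₀ : Ω → ℂ) (α σ2 β₀ d : ℝ) (q : Ω → ℝ) : ℝ :=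
  P.real {ω | ENNReal.ofReal β₀ ≤
    sinr α σ2 d (q ω) (h₀ ω) (fun k => X k ω) (fun k => p k ω) (fun k => h k ω)}

/-- Admissible laws of the uplink transmit power: average power `Pavg`, peak power `Pmax`. -/
structure IsFeasible (Pavg Pmax : ℝ) (ν : Measure ℝ) : Prop where
  prob : IsProbabilityMeasure ν
  peak : ∀ᵐ q ∂ν, 0 ≤ q ∧ q ≤ Pmax
  average : ∫ q, q ∂ν = Pavg

/-- `ν` is an admissible law of the uplink transmit power that maximizes the average over the
transmit power `q ∼ ν` of the conditional coverage probability `φ q`. -/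
structure IsOptimalLaw (Pavg Pmax : ℝ) (φ : ℝ → ℝ) (ν : Measure ℝ) : Prop where
  feasible : IsFeasible Pavg Pmax ν
  optimal : ∀ ν' : Measure ℝ, IsFeasible Pavg Pmax ν' → ∫ q, φ q ∂ν' ≤ ∫ q, φ q ∂ν

/-- On-off law with average power `Pavg`: power `q` with probability `Pavg / q`, else power `0`. -/
def onOffLaw (Pavg q : ℝ) : Measure ℝ :=
  ENNReal.ofReal (Pavg / q) • Measure.dirac q + ENNReal.ofReal (1 - Pavg / q) • Measure.dirac 0

/-- Expected number `E[K]` of D2D transmitters in the cell, the disk of radius `R`. -/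
def meanCount {Ω : Type*} [MeasurableSpace Ω] (P : Measure Ω) (X : ℕ → Ω → Plane) (R : ℝ) : ℝ :=
  (∫⁻ ω, pointCount X (Metric.closedBall 0 R) ω ∂P).toReal

/-- Normalized cardinal sine `sin (π x) / (π x)`. -/
def nsinc (x : ℝ) : ℝ := Real.sinc (Real.pi * x)

/-- Fractional moment `E[p_k ^ (2/α)]` of the D2D transmit power. -/
def powerMoment (α : ℝ) (F : Measure ℝ) : ℝ := ∫ q, q ^ (2 / α) ∂F

/-- The power level `p̃₀(d)`, with `EK` standing for `E[K]` and `M` for `E[p_k ^ (2/α)]`. -/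
def pTilde (α β₀ R EK M d : ℝ) : ℝ :=
  (2 * M / (α * nsinc (2 / α))) ^ (α / 2) * EK ^ (α / 2) * β₀ * (d / R) ^ α

end D2D

end

/-! Write δ = 2/α. Under Rayleigh fading `‖h₀‖ ^ 2` is exponential with mean 1, so conditioning on
the interference I gives φ(q) = E exp(-sI) with s = β₀ d^α / q (`stdComplexNormal_le_sinr`,
`IsUplinkNetwork.measure_le_sinr`). The Laplace functional of the marked Poisson process
(`IsUplinkNetwork.laplace`) turns this into a planar integral of 1 - exp(-s·signal). That integral
scales as s^δ and contributes Γ(1-δ); the fading moment contributes Γ(1+δ), and their product is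
1/sinc δ. Hence φ(q) = exp(-c q^(-δ)) for q > 0 and φ(q) = 0 for q ≤ 0
(`IsUplinkNetwork.coverage_const`).

The optimization is linear duality: if φ(q) ≤ A + Bq on [0, Pmax], then every admissible law has ∫ φ
≤ A + B·Pavg, because only the mean enters (`IsFeasible.integral_le`). The profile is S-shaped, and
the line from the origin to (q, φ(q)) is steepest where cδ q^(-δ) = 1, that is at p̃₀. The
dominating line is the tangent at Pavg if p̃₀ ≤ Pavg, the chord from 0 to Pmax if p̃₀ ≥ Pmax, and
otherwise the tangent at p̃₀, which passes through the origin (`exists_affine_bound`). The on-off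
law attains the bound, so every optimal law has that same coverage. -/

namespace D2D

open Filter Topology

/-! ### Exponentials of extended nonnegative numbers and Poisson transforms -/

/-- `exp (-t)` for extended nonnegative `t`, with `exp (-∞) = 0`. -/
noncomputable def expNeg (t : ℝ≥0∞) : ℝ≥0∞ := EReal.exp (-(t : EReal))

lemma continuous_expNeg : Continuous expNeg :=
  ENNReal.continuous_exp.comp (continuous_neg.comp continuous_coe_ennreal_ereal)

@[fun_prop]
lemma measurable_expNeg : Measurable expNeg := continuous_expNeg.measurable

@[simp] lemma expNeg_zero : expNeg 0 = 1 := by simp [expNeg]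

@[simp] lemma expNeg_top : expNeg ∞ = 0 := by simp [expNeg]

lemma expNeg_add (a b : ℝ≥0∞) : expNeg (a + b) = expNeg a * expNeg b := by
  rw [expNeg, EReal.coe_ennreal_add, EReal.neg_add, sub_eq_add_neg, EReal.exp_add, expNeg, expNeg]
  · left; simp
  · right; simp

lemma expNeg_le_one (a : ℝ≥0∞) : expNeg a ≤ 1 := by
  simp [expNeg]
  exact EReal.coe_ennreal_nonneg a

lemma antitone_expNeg : Antitone expNeg := fun a b h ↦ by
  simpa [expNeg] using h

lemma expNeg_ofReal {x : ℝ} (hx : 0 ≤ x) :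
    expNeg (ENNReal.ofReal x) = ENNReal.ofReal (Real.exp (-x)) := by
  rw [expNeg, EReal.coe_ennreal_ofReal, max_eq_left hx, ← EReal.coe_neg, EReal.exp_coe]

lemma expNeg_sum {ι : Type*} (s : Finset ι) (f : ι → ℝ≥0∞) :
    expNeg (∑ i ∈ s, f i) = ∏ i ∈ s, expNeg (f i) := by
  classical
  induction s using Finset.induction_on with
  | empty => simp
  | insert a s ha ih => rw [Finset.sum_insert ha, Finset.prod_insert ha, expNeg_add, ih]

lemma expNeg_mul_natCast (a : ℝ≥0∞) (n : ℕ) : expNeg (a * n) = expNeg a ^ n := by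
  have := expNeg_sum (Finset.range n) (fun _ ↦ a)
  simpa [mul_comm] using this

/-- Lets a factor averaged over the marks be rewritten as `expNeg` of a function of the location
alone. The witness is -log g, which is ∞ where g vanishes. -/
lemma exists_expNeg_eq {A : Type*} [MeasurableSpace A] {g : A → ℝ≥0∞} (hg : Measurable g)
    (hg1 : ∀ x, g x ≤ 1) : ∃ u : A → ℝ≥0∞, Measurable u ∧ ∀ x, expNeg (u x) = g x := by
  refine ⟨fun x ↦ (-(ENNReal.log (g x))).toENNReal, ?_, fun x ↦ ?_⟩
  · exact measurable_ereal_toENNReal.comp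
      (continuous_neg.measurable.comp (ENNReal.measurable_log.comp hg))
  · rw [expNeg, EReal.coe_toENNReal, neg_neg, ENNReal.exp_log]
    have := hg1 x
    rw [EReal.le_neg]
    simpa using this

/-- Laplace transform of the Poisson distribution. -/
lemma lintegral_expNeg_poissonMeasure (m : ℝ≥0) (a : ℝ≥0∞) :
    ∫⁻ n, expNeg (a * (n : ℝ≥0∞)) ∂(poissonMeasure m) = expNeg (m * (1 - expNeg a)) := by
  have hfin : expNeg a ≠ ∞ := ((expNeg_le_one a).trans_lt ENNReal.one_lt_top).ne
  obtain ⟨g, hg⟩ : ∃ g : ℝ≥0, expNeg a = g := ⟨_, (ENNReal.coe_toNNReal hfin).symm⟩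
  have hg1 : (g : ℝ) ≤ 1 := by
    have := expNeg_le_one a
    rw [hg] at this
    exact_mod_cast this
  have hR : (m : ℝ≥0∞) * (1 - expNeg a) = ENNReal.ofReal (m * (1 - g)) := by
    rw [hg, ENNReal.ofReal_mul (by positivity), ENNReal.ofReal_sub _ (by positivity)]
    simp
  rw [hR, expNeg_ofReal (mul_nonneg (by positivity) (by linarith)), poissonMeasure,
    lintegral_sum_measure]
  simp only [lintegral_smul_measure, lintegral_dirac, expNeg_mul_natCast, hg, smul_eq_mul]
  have hs := (NormedSpace.expSeries_div_hasSum_exp (𝔸 := ℝ) ((m : ℝ) * g)).mul_left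
    (Real.exp (-m))
  rw [← Real.exp_eq_exp_ℝ, ← Real.exp_add] at hs
  have e : -(m : ℝ) * (1 - g) = -m + m * g := by ring
  rw [← neg_mul, e, ← hs.tsum_eq, ENNReal.ofReal_tsum_of_nonneg (fun n ↦ by positivity)
    hs.summable]
  refine tsum_congr fun n ↦ ?_
  rw [← ENNReal.ofReal_coe_nnreal, ← ENNReal.ofReal_pow (by positivity),
    ← ENNReal.ofReal_mul (by positivity)]
  congr 1
  rw [mul_pow]; ring

/-- Mean of the Poisson distribution. -/
lemma lintegral_natCast_poissonMeasure (m : ℝ≥0) :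
    ∫⁻ n, (n : ℝ≥0∞) ∂(poissonMeasure m) = m := by
  rw [poissonMeasure, lintegral_sum_measure]
  simp only [lintegral_smul_measure, lintegral_dirac, smul_eq_mul]
  rw [tsum_eq_zero_add' ENNReal.summable]
  have hs := (NormedSpace.expSeries_div_hasSum_exp (𝔸 := ℝ) (m : ℝ)).mul_left
    (m * Real.exp (-m))
  rw [← Real.exp_eq_exp_ℝ, mul_assoc, ← Real.exp_add] at hs
  simp only [neg_add_cancel, Real.exp_zero, mul_one] at hs
  have hm : (m : ℝ≥0∞) = ∑' n : ℕ, ENNReal.ofReal (m * Real.exp (-m) * (m ^ n / n.factorial)) := by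
    rw [← ENNReal.ofReal_tsum_of_nonneg (fun n ↦ by positivity) hs.summable, hs.tsum_eq]
    simp
  rw [hm]
  simp only [Nat.cast_zero, mul_zero, zero_add]
  refine tsum_congr fun n ↦ ?_
  rw [← ENNReal.ofReal_natCast, ← ENNReal.ofReal_mul (by positivity)]
  congr 1
  rw [Nat.factorial_succ, pow_succ]
  push_cast
  field_simp

lemma measurable_pointCount {Ω : Type*} [MeasurableSpace Ω] {X : ℕ → Ω → Plane}
    (hX : ∀ k, Measurable (X k)) {B : Set Plane} (hB : MeasurableSet B) :
    Measurable (pointCount X B) :=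
  Measurable.tsum fun k ↦ (measurable_const.indicator hB).comp (hX k)

/-- Partial products converge to the exponential of the series, also in expectation. -/
lemma tendsto_lintegral_prod_expNeg {Ω : Type*} [MeasurableSpace Ω] (P : Measure Ω)
    [IsProbabilityMeasure P] {a : ℕ → Ω → ℝ≥0∞} (ha : ∀ k, Measurable (a k)) :
    Tendsto (fun n ↦ ∫⁻ ω, ∏ k ∈ Finset.range n, expNeg (a k ω) ∂P) atTop
      (𝓝 (∫⁻ ω, expNeg (∑' k, a k ω) ∂P)) := by
  simp_rw [← expNeg_sum]
  refine tendsto_lintegral_of_dominated_convergence (fun _ ↦ 1) (fun n ↦ ?_)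
    (fun n ↦ .of_forall fun ω ↦ expNeg_le_one _) (by simp) (.of_forall fun ω ↦ ?_)
  · exact measurable_expNeg.comp (Finset.measurable_sum _ fun k _ ↦ ha k)
  · exact (continuous_expNeg.tendsto _).comp ENNReal.summable.hasSum.tendsto_sum_nat

/-! ### Laplace functional of the Poisson point process -/

section Laplace

variable {Ω : Type*} [MeasurableSpace Ω] {P : Measure Ω} {lam : ℝ} {X : ℕ → Ω → Plane}

lemma IsPoissonPointProcess.lintegral_expNeg_pointCount (hX : IsPoissonPointProcess P lam X)
    (hlam : 0 ≤ lam) {B : Set Plane} (hB : MeasurableSet B) (hB' : volume B ≠ ∞) (a : ℝ≥0∞) :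
    ∫⁻ ω, expNeg (a * pointCount X B ω) ∂P =
      expNeg (ENNReal.ofReal lam * ((1 - expNeg a) * volume B)) := by
  have h1 : Measurable fun t : ℝ≥0∞ ↦ expNeg (a * t) := by fun_prop
  have h2 := lintegral_map (μ := P) h1 (measurable_pointCount hX.measurable hB)
  rw [← h2, hX.poisson B hB hB', lintegral_map h1 (by fun_prop), lintegral_expNeg_poissonMeasure]
  congr 1
  rw [← ENNReal.ofReal, ENNReal.ofReal_mul hlam, ENNReal.ofReal_toReal hB']
  ring

/-- The sum over points is a finite combination of counts on the disjoint level sets, which are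
independent Poisson variables. The level set of 0 contributes nothing, so its area may be infinite.
-/
lemma IsPoissonPointProcess.lintegral_expNeg_simpleFunc (hX : IsPoissonPointProcess P lam X)
    (hlam : 0 ≤ lam) (s : SimpleFunc Plane ℝ≥0∞) (hs : ∀ a ≠ 0, volume (s ⁻¹' {a}) ≠ ∞) :
    ∫⁻ ω, expNeg (∑' k, s (X k ω)) ∂P =
      expNeg (ENNReal.ofReal lam * ∫⁻ x, (1 - expNeg (s x))) := by
  have hsum : ∀ ω, ∑' k, s (X k ω) = ∑ a ∈ s.range, a * pointCount X (s ⁻¹' {a}) ω := by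
    intro ω
    simp only [pointCount, ← ENNReal.tsum_mul_left]
    rw [← Summable.tsum_finsetSum (fun _ _ ↦ ENNReal.summable)]
    refine tsum_congr fun k ↦ ?_
    rw [Finset.sum_eq_single (s (X k ω))]
    · simp
    · intro b _ hb
      simp [Set.indicator, hb.symm]
    · intro hb
      exact absurd (s.mem_range_self _) hb
  have hint : ∫⁻ x, (1 - expNeg (s x)) = ∑ a ∈ s.range, (1 - expNeg a) * volume (s ⁻¹' {a}) := by
    have := SimpleFunc.lintegral_eq_lintegral (s.map fun a ↦ 1 - expNeg a) (volume : Measure Plane)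
    rw [SimpleFunc.map_lintegral] at this
    simpa using this
  have hpi : iIndepFun (fun (i : s.range) ω ↦ pointCount X (s ⁻¹' {(i : ℝ≥0∞)}) ω) P := by
    let e : Fin (Fintype.card s.range) ≃ s.range := (Fintype.equivFin s.range).symm
    have := hX.indep _ (fun i ↦ s ⁻¹' {(e i : ℝ≥0∞)}) (fun i ↦ s.measurableSet_fiber _) ?_
    · have h3 := this.precomp e.symm.injective
      convert h3 using 3 with i
      simp
    · intro i j hij
      refine Disjoint.preimage _ ?_
      simpa using fun h ↦ hij (e.injective (Subtype.ext h))
  simp_rw [hsum, expNeg_sum]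
  rw [hint, Finset.mul_sum, expNeg_sum]
  simp_rw [← Finset.prod_coe_sort s.range]
  have hi2 := hpi.comp (fun (i : s.range) t ↦ expNeg (i * t)) (fun i ↦ by fun_prop)
  have h5 := lintegral_prod_eq_prod_lintegral_of_indepFun Finset.univ _ hi2 (fun i ↦ by
    have := measurable_pointCount hX.measurable (s.measurableSet_fiber (i : ℝ≥0∞))
    exact (show Measurable fun t ↦ expNeg (i * t) by fun_prop).comp this)
  refine h5.trans (Finset.prod_congr rfl fun i _ ↦ ?_)
  by_cases hi : (i : ℝ≥0∞) = 0
  · have := hpi.isProbabilityMeasure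
    simp [hi]
  · exact hX.lintegral_expNeg_pointCount hlam (s.measurableSet_fiber _) (hs _ hi) _

/-- Laplace functional of the Poisson point process. -/
theorem IsPoissonPointProcess.laplace [IsProbabilityMeasure P] (hX : IsPoissonPointProcess P lam X)
    (hlam : 0 ≤ lam) {u : Plane → ℝ≥0∞} (hu : Measurable u) :
    ∫⁻ ω, expNeg (∑' k, u (X k ω)) ∂P =
      expNeg (ENNReal.ofReal lam * ∫⁻ x, (1 - expNeg (u x))) := by
  -- Cutting off to balls gives the nonzero level sets finite area while keeping the approximation
  -- monotone.
  let s : ℕ → SimpleFunc Plane ℝ≥0∞ := fun n ↦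
    (SimpleFunc.eapprox u n).restrict (Metric.ball 0 n)
  have hs : ∀ n x, s n x = (Metric.ball (0 : Plane) n).indicator (SimpleFunc.eapprox u n) x :=
    fun n x ↦ by simp [s, SimpleFunc.restrict_apply _ measurableSet_ball]
  have hmono : ∀ x, Monotone fun n ↦ s n x := by
    intro x m n hmn
    simp only [hs]
    refine (Set.indicator_le_indicator (SimpleFunc.monotone_eapprox u hmn x)).trans ?_
    exact Set.indicator_le_indicator_of_subset
      (Metric.ball_subset_ball (by exact_mod_cast hmn)) (fun _ ↦ zero_le) x
  have hlim : ∀ x, Tendsto (fun n ↦ s n x) atTop (𝓝 (u x)) := by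
    intro x
    refine (SimpleFunc.tendsto_eapprox hu x).congr' ?_
    obtain ⟨N, hN⟩ := exists_nat_gt ‖x‖
    filter_upwards [eventually_ge_atTop N] with n hn
    rw [hs, Set.indicator_of_mem]
    have : (N : ℝ) ≤ n := by exact_mod_cast hn
    simpa using hN.trans_le this
  have hfin : ∀ n, ∀ a ≠ 0, volume (s n ⁻¹' {a}) ≠ ∞ := by
    intro n a ha
    refine ((measure_mono ?_).trans_lt (measure_ball_lt_top (x := (0 : Plane)) (r := n))).ne
    intro x hx
    by_contra hxn
    simp only [Set.mem_preimage, hs, Set.indicator_of_notMem hxn, Set.mem_singleton_iff] at hx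
    exact ha hx.symm
  have hsup : ∀ x, ⨆ n, s n x = u x := fun x ↦ iSup_eq_of_tendsto (hmono x) (hlim x)
  have hL : Tendsto (fun n ↦ ∫⁻ ω, expNeg (∑' k, s n (X k ω)) ∂P) atTop
      (𝓝 (∫⁻ ω, expNeg (∑' k, u (X k ω)) ∂P)) := by
    refine tendsto_lintegral_of_dominated_convergence (fun _ ↦ 1) (fun n ↦ ?_)
      (fun n ↦ .of_forall fun ω ↦ expNeg_le_one _) (by simp) (.of_forall fun ω ↦ ?_)
    · exact measurable_expNeg.comp
        (Measurable.tsum fun k ↦ (s n).measurable.comp (hX.measurable k))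
    · refine (continuous_expNeg.tendsto _).comp ?_
      -- A series is an integral against counting measure, so monotone convergence applies.
      have h1 : ∑' k, u (X k ω) = ⨆ n, ∑' k, s n (X k ω) := by
        simp_rw [← hsup]
        simp only [← lintegral_count]
        exact lintegral_iSup (fun n ↦ .of_discrete) (fun m n hmn k ↦ hmono _ hmn)
      rw [h1]
      exact tendsto_atTop_iSup fun m n hmn ↦ ENNReal.tsum_le_tsum fun k ↦ hmono _ hmn
  have hR : Tendsto (fun n ↦ expNeg (ENNReal.ofReal lam * ∫⁻ x, (1 - expNeg (s n x)))) atTop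
      (𝓝 (expNeg (ENNReal.ofReal lam * ∫⁻ x, (1 - expNeg (u x))))) := by
    refine (continuous_expNeg.tendsto _).comp
      (ENNReal.Tendsto.const_mul ?_ (Or.inr ENNReal.ofReal_ne_top))
    refine lintegral_tendsto_of_tendsto_of_monotone
      (fun n ↦ (measurable_const.sub (measurable_expNeg.comp (s n).measurable)).aemeasurable)
      (.of_forall fun x m n hmn ↦ tsub_le_tsub_left (antitone_expNeg (hmono x hmn)) _)
      (.of_forall fun x ↦ ?_)
    exact ENNReal.Tendsto.sub tendsto_const_nhds
      ((continuous_expNeg.tendsto _).comp (hlim x)) (Or.inl ENNReal.one_ne_top)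
  refine tendsto_nhds_unique hL (hR.congr fun n ↦ ?_)
  exact (hX.lintegral_expNeg_simpleFunc hlam (s n) (hfin n)).symm

end Laplace

/-! ### Independence, and integrating out the marks -/

section Independence

variable {Ω A B : Type*} [MeasurableSpace Ω] [MeasurableSpace A] [MeasurableSpace B]
  {P : Measure Ω} [IsProbabilityMeasure P]

lemma lintegral_of_indepFun {U : Ω → A} {W : Ω → B} (hU : Measurable U) (hW : Measurable W)
    (hUW : IndepFun U W P) {f : A → B → ℝ≥0∞} (hf : Measurable (Function.uncurry f)) :
    ∫⁻ ω, f (U ω) (W ω) ∂P = ∫⁻ ω, ∫⁻ ω', f (U ω) (W ω') ∂P ∂P := by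
  have := Measure.isProbabilityMeasure_map (μ := P) hU.aemeasurable
  have := Measure.isProbabilityMeasure_map (μ := P) hW.aemeasurable
  have h1 := (indepFun_iff_map_prod_eq_prod_map_map hU.aemeasurable hW.aemeasurable).1 hUW
  have h2 := lintegral_map (μ := P) hf (hU.prodMk hW)
  refine h2.symm.trans ?_
  rw [h1, lintegral_prod _ hf.aemeasurable, lintegral_map hf.lintegral_prod_right' hU]
  refine lintegral_congr fun ω ↦ ?_
  exact lintegral_map (f := fun y ↦ f (U ω) y) (hf.comp measurable_prodMk_left) hW

lemma measure_of_indepFun {U : Ω → A} {W : Ω → B} (hU : Measurable U) (hW : Measurable W)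
    (hUW : IndepFun U W P) {S : Set (A × B)} (hS : MeasurableSet S) :
    P {ω | (U ω, W ω) ∈ S} = ∫⁻ ω, P {ω' | (U ω, W ω') ∈ S} ∂P := by
  have hf : Measurable (Function.uncurry fun a b ↦ S.indicator (1 : A × B → ℝ≥0∞) (a, b)) :=
    measurable_one.indicator hS
  have h := lintegral_of_indepFun hU hW hUW hf
  have h1 : ∀ {g : Ω → A × B}, Measurable g →
      ∫⁻ ω, S.indicator (1 : A × B → ℝ≥0∞) (g ω) ∂P = P {ω | g ω ∈ S} := by
    intro g hg
    rw [← lintegral_map (measurable_one.indicator hS) hg, lintegral_indicator_one hS,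
      Measure.map_apply hg hS]
    rfl
  rw [h1 (hU.prodMk hW)] at h
  rw [h]
  exact lintegral_congr fun ω ↦ h1 (measurable_const.prodMk hW)

/-- With `X` frozen, the factors are functions of independent variables with law `ν`, so the
expectation factorizes. -/
lemma lintegral_prod_of_indepFun_iid {X : Ω → A} {Y : ℕ → Ω → B} {ν : Measure B}
    (hX : Measurable X) (hY : ∀ k, Measurable (Y k)) (hXY : IndepFun X (fun ω k ↦ Y k ω) P)
    (hYi : iIndepFun Y P) (hν : ∀ k, P.map (Y k) = ν) {f : ℕ → A → B → ℝ≥0∞}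
    (hf : ∀ k, Measurable (Function.uncurry (f k))) (n : ℕ) :
    ∫⁻ ω, ∏ k ∈ Finset.range n, f k (X ω) (Y k ω) ∂P =
      ∫⁻ ω, ∏ k ∈ Finset.range n, ∫⁻ y, f k (X ω) y ∂ν ∂P := by
  rw [lintegral_of_indepFun (f := fun x y ↦ ∏ k ∈ Finset.range n, f k x (y k)) hX
    (measurable_pi_lambda _ hY) hXY]
  · refine lintegral_congr fun ω ↦ ?_
    have hm : ∀ k, Measurable fun y ↦ f k (X ω) y := fun k ↦ (hf k).comp measurable_prodMk_left
    rw [lintegral_prod_eq_prod_lintegral_of_indepFun (Finset.range n)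
      (fun k ω' ↦ f k (X ω) (Y k ω')) (hYi.comp _ hm) (fun k ↦ (hm k).comp (hY k))]
    refine Finset.prod_congr rfl fun k _ ↦ ?_
    rw [← hν k, lintegral_map (hm k) (hY k)]
  · refine Finset.measurable_prod _ fun k _ ↦ ?_
    exact (hf k).comp (measurable_fst.prodMk ((measurable_pi_apply k).comp measurable_snd))

end Independence

lemma isProbabilityMeasure_of_map_eq {Ω A : Type*} [MeasurableSpace Ω] [MeasurableSpace A]
    {P : Measure Ω} [IsProbabilityMeasure P] {Y : Ω → A} {ν : Measure A} (hY : Measurable Y)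
    (h : P.map Y = ν) : IsProbabilityMeasure ν :=
  h ▸ Measure.isProbabilityMeasure_map hY.aemeasurable

/-- Laplace functional of the Poisson point process of transmitters, marked by their transmit
powers and fading coefficients. -/
theorem IsUplinkNetwork.laplace {Ω : Type*} [MeasurableSpace Ω] {P : Measure Ω}
    [IsProbabilityMeasure P] {lam : ℝ} {F : Measure ℝ} {X : ℕ → Ω → Plane} {p : ℕ → Ω → ℝ}
    {h : ℕ → Ω → ℂ} {h₀ : Ω → ℂ} (hnet : IsUplinkNetwork P lam F X p h h₀) (hlam : 0 ≤ lam)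
    {J : Plane → ℝ → ℂ → ℝ≥0∞} (hJ : Measurable fun z : Plane × ℝ × ℂ ↦ J z.1 z.2.1 z.2.2) :
    ∫⁻ ω, expNeg (∑' k, J (X k ω) (p k ω) (h k ω)) ∂P =
      expNeg (ENNReal.ofReal lam *
        ∫⁻ q, ∫⁻ g, ∫⁻ x, (1 - expNeg (J x q g)) ∂volume ∂stdComplexNormal ∂F) := by
  have hX := hnet.ppp.measurable
  have hp := hnet.measurable_power
  have hh := hnet.measurable_fading
  have hPF : IsProbabilityMeasure F := isProbabilityMeasure_of_map_eq (hp 0) (hnet.law_power 0)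
  have hPN : IsProbabilityMeasure stdComplexNormal :=
    isProbabilityMeasure_of_map_eq (hh 0) (hnet.law_fading 0)
  have hE : Measurable fun z : (Plane × ℝ) × ℂ ↦ expNeg (J z.1.1 z.1.2 z.2) :=
    measurable_expNeg.comp (hJ.comp
      (by fun_prop : Measurable fun z : (Plane × ℝ) × ℂ ↦ (z.1.1, z.1.2, z.2)))
  have hG1 : Measurable fun z : Plane × ℝ ↦ ∫⁻ g, expNeg (J z.1 z.2 g) ∂stdComplexNormal :=
    hE.lintegral_prod_right'
  have hG2 : Measurable fun x : Plane ↦ ∫⁻ q, ∫⁻ g, expNeg (J x q g) ∂stdComplexNormal ∂F :=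
    hG1.lintegral_prod_right'
  have hle : ∀ x, ∫⁻ q, ∫⁻ g, expNeg (J x q g) ∂stdComplexNormal ∂F ≤ 1 := fun x ↦
    calc _ ≤ ∫⁻ q, ∫⁻ g, 1 ∂stdComplexNormal ∂F :=
          lintegral_mono fun q ↦ lintegral_mono fun g ↦ expNeg_le_one _
      _ = 1 := by simp
  -- `u` absorbs both marks: the marked functional equals the unmarked one of `u`. This is checked
  -- on finite products, fading integrated out before powers, and then passed to the limit.
  obtain ⟨u, hu, hue⟩ := exists_expNeg_eq hG2 hle
  have hfin : ∀ n, ∫⁻ ω, ∏ k ∈ Finset.range n, expNeg (J (X k ω) (p k ω) (h k ω)) ∂P =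
      ∫⁻ ω, ∏ k ∈ Finset.range n, expNeg (u (X k ω)) ∂P := by
    intro n
    simp_rw [hue]
    rw [lintegral_prod_of_indepFun_iid
        (f := fun k (z : (ℕ → Plane) × (ℕ → ℝ)) g ↦ expNeg (J (z.1 k) (z.2 k) g))
        ((measurable_pi_lambda _ hX).prodMk (measurable_pi_lambda _ hp)) hh hnet.indep_fading
        hnet.iIndep_fading hnet.law_fading,
      lintegral_prod_of_indepFun_iid
        (f := fun k (z : ℕ → Plane) q ↦ ∫⁻ g, expNeg (J (z k) q g) ∂stdComplexNormal)
        (measurable_pi_lambda _ hX) hp hnet.indep_loc_power hnet.iIndep_power hnet.law_power]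
    · exact fun k ↦ hG1.comp (by fun_prop : Measurable fun z : (ℕ → Plane) × ℝ ↦ (z.1 k, z.2))
    · exact fun k ↦ hE.comp (by fun_prop :
        Measurable fun z : ((ℕ → Plane) × (ℕ → ℝ)) × ℂ ↦ ((z.1.1 k, z.1.2 k), z.2))
  have h1 := tendsto_lintegral_prod_expNeg P
    (a := fun k ω ↦ J (X k ω) (p k ω) (h k ω)) fun k ↦
      hJ.comp ((hX k).prodMk ((hp k).prodMk (hh k)))
  have h2 := tendsto_lintegral_prod_expNeg P (a := fun k ω ↦ u (X k ω)) fun k ↦ hu.comp (hX k)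
  simp_rw [hfin] at h1
  rw [tendsto_nhds_unique h1 h2, hnet.ppp.laplace hlam hu]
  congr 2
  have hsub1 : ∀ x q, ∫⁻ g, (1 - expNeg (J x q g)) ∂stdComplexNormal =
      1 - ∫⁻ g, expNeg (J x q g) ∂stdComplexNormal := by
    intro x q
    have hm : Measurable fun g ↦ expNeg (J x q g) :=
      hE.comp (by fun_prop : Measurable fun g : ℂ ↦ ((x, q), g))
    rw [lintegral_sub hm _ (.of_forall fun g ↦ expNeg_le_one _)]
    · simp
    · refine ((lintegral_mono fun g ↦ expNeg_le_one _).trans_lt ?_).ne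
      simp
  have hsub2 : ∀ x, 1 - expNeg (u x) = ∫⁻ q, ∫⁻ g, (1 - expNeg (J x q g)) ∂stdComplexNormal ∂F := by
    intro x
    simp_rw [hsub1, hue]
    have hm : Measurable fun q ↦ ∫⁻ g, expNeg (J x q g) ∂stdComplexNormal :=
      hG1.comp (by fun_prop : Measurable fun q : ℝ ↦ (x, q))
    rw [lintegral_sub hm ((hle x).trans_lt ENNReal.one_lt_top).ne (.of_forall fun q ↦ ?_)]
    · simp
    · refine (lintegral_mono fun g ↦ expNeg_le_one _).trans ?_
      simp
  simp_rw [hsub2]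
  have hD : Measurable fun z : (Plane × ℝ) × ℂ ↦ 1 - expNeg (J z.1.1 z.1.2 z.2) :=
    measurable_const.sub hE
  -- The location integral is moved innermost, where it has a closed form.
  rw [lintegral_lintegral_swap (f := fun x q ↦ ∫⁻ g, (1 - expNeg (J x q g)) ∂stdComplexNormal)
    hD.lintegral_prod_right'.aemeasurable]
  refine lintegral_congr fun q ↦ ?_
  exact lintegral_lintegral_swap (f := fun x g ↦ 1 - expNeg (J x q g))
    (hD.comp (by fun_prop : Measurable fun z : Plane × ℂ ↦ ((z.1, q), z.2))).aemeasurable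

/-! ### Radial integrals: Rayleigh fading and path loss -/

section Planar

variable {V : Type*} [NormedAddCommGroup V] [MeasurableSpace V] [BorelSpace V] {μ : Measure V}

/-- If balls of radius `r` have area `π r²`, then areas of annuli are proportional to the
difference of the squared radii. -/
lemma map_norm_sq (hμ : ∀ r, μ (Metric.ball 0 r) = ENNReal.ofReal r ^ 2 * ENNReal.ofReal Real.pi) :
    μ.map (fun x ↦ ‖x‖ ^ 2) = ENNReal.ofReal Real.pi • volume.restrict (Set.Ioi 0) := by
  have hm : Measurable fun x : V ↦ ‖x‖ ^ 2 := by fun_prop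
  have hpre : ∀ b : ℝ, μ.map (fun x ↦ ‖x‖ ^ 2) (Set.Iio b) =
      ENNReal.ofReal Real.pi * ENNReal.ofReal b := by
    intro b
    rw [Measure.map_apply hm measurableSet_Iio]
    rcases le_or_gt b 0 with hb | hb
    · have : (fun x : V ↦ ‖x‖ ^ 2) ⁻¹' Set.Iio b = ∅ := by
        ext x
        simpa using hb.trans (by positivity)
      rw [this, ENNReal.ofReal_of_nonpos hb]
      simp
    · have : (fun x : V ↦ ‖x‖ ^ 2) ⁻¹' Set.Iio b = Metric.ball 0 √b := by
        ext x
        simp [Real.lt_sqrt (norm_nonneg x)]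
      rw [this, hμ, ← ENNReal.ofReal_pow (Real.sqrt_nonneg b), Real.sq_sqrt hb.le, mul_comm]
  refine Measure.ext_of_generateFrom_of_iUnion (Set.range Set.Iio) (fun n : ℕ ↦ Set.Iio (n : ℝ))
    (borel_eq_generateFrom_Iio ℝ ▸ BorelSpace.measurable_eq) isPiSystem_Iio ?_ ?_ ?_ ?_
  · refine Set.eq_univ_of_forall fun x ↦ Set.mem_iUnion.2 ?_
    exact exists_nat_gt x
  · exact fun n ↦ ⟨_, rfl⟩
  · intro n
    rw [hpre]
    exact ENNReal.mul_ne_top ENNReal.ofReal_ne_top ENNReal.ofReal_ne_top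
  · rintro _ ⟨b, rfl⟩
    rw [hpre, Measure.smul_apply, Measure.restrict_apply measurableSet_Iio, Set.Iio_inter_Ioi,
      Real.volume_Ioo, sub_zero, smul_eq_mul]

/-- General in `V` so as to serve both the fading in ℂ and the locations in `Plane`. -/
lemma lintegral_norm_sq
    (hμ : ∀ r, μ (Metric.ball 0 r) = ENNReal.ofReal r ^ 2 * ENNReal.ofReal Real.pi)
    {f : ℝ → ℝ≥0∞} (hf : Measurable f) :
    ∫⁻ x, f (‖x‖ ^ 2) ∂μ = ENNReal.ofReal Real.pi * ∫⁻ t in Set.Ioi 0, f t := by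
  rw [← lintegral_map hf (by fun_prop : Measurable fun x : V ↦ ‖x‖ ^ 2), map_norm_sq hμ,
    lintegral_smul_measure, smul_eq_mul]

end Planar

/-- The squared modulus of a standard complex normal variable is exponentially distributed. -/
lemma lintegral_stdComplexNormal {f : ℝ → ℝ≥0∞} (hf : Measurable f) :
    ∫⁻ z, f (‖z‖ ^ 2) ∂stdComplexNormal =
      ∫⁻ t in Set.Ioi 0, ENNReal.ofReal (Real.exp (-t)) * f t := by
  have hv : (1 / 2 : ℝ≥0) ≠ 0 := by simp
  have hmap : stdComplexNormal =
      ((gaussianReal 0 (1 / 2)).prod (gaussianReal 0 (1 / 2))).map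
        Complex.measurableEquivRealProd.symm := rfl
  have hF : Measurable fun z : ℂ ↦ f (‖z‖ ^ 2) := hf.comp (by fun_prop)
  have hg := measurable_gaussianPDF 0 (1 / 2)
  rw [hmap, lintegral_map hF (MeasurableEquiv.measurable _), gaussianReal_of_var_ne_zero _ hv,
    prod_withDensity hg hg, ← Measure.volume_eq_prod]
  refine (lintegral_withDensity_eq_lintegral_mul _
    ((hg.comp measurable_fst).mul (hg.comp measurable_snd))
    (hF.comp Complex.measurableEquivRealProd.symm.measurable)).trans ?_
  -- The joint density is radial, π⁻¹ exp(-|z|²); its π⁻¹ cancels the π of `lintegral_norm_sq`.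
  have hden : ∀ z : ℝ × ℝ, gaussianPDF 0 (1 / 2) z.1 * gaussianPDF 0 (1 / 2) z.2 =
      ENNReal.ofReal (Real.pi⁻¹ *
        Real.exp (-‖Complex.measurableEquivRealProd.symm z‖ ^ 2)) := by
    intro z
    have h1 : ‖Complex.measurableEquivRealProd.symm z‖ ^ 2 = z.1 ^ 2 + z.2 ^ 2 := by
      rw [← Complex.normSq_eq_norm_sq, Complex.normSq_apply]
      simp [Complex.measurableEquivRealProd, sq]
    rw [gaussianPDF, gaussianPDF, ← ENNReal.ofReal_mul (gaussianPDFReal_nonneg _ _ _), h1]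
    congr 1
    simp only [gaussianPDFReal_def, sub_zero]
    rw [mul_mul_mul_comm, ← Real.exp_add, ← mul_inv, Real.mul_self_sqrt (by positivity)]
    have e1 : (2 * Real.pi * ((1 / 2 : ℝ≥0) : ℝ)) = Real.pi := by
      push_cast; ring
    have e2 : (2 * ((1 / 2 : ℝ≥0) : ℝ)) = 1 := by
      push_cast; ring
    rw [e1, e2]
    congr 2
    ring
  have h2 := (Complex.volume_preserving_equiv_real_prod.symm).lintegral_comp
    (f := fun z : ℂ ↦ ENNReal.ofReal (Real.pi⁻¹ * Real.exp (-‖z‖ ^ 2)) * f (‖z‖ ^ 2))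
    (by fun_prop)
  simp only [Pi.mul_apply, Function.comp_apply, hden]
  have h3 : Measurable fun t : ℝ ↦ ENNReal.ofReal (Real.pi⁻¹ * Real.exp (-t)) * f t := by fun_prop
  refine h2.trans ((lintegral_norm_sq (μ := (volume : Measure ℂ)) ?_ h3).trans ?_)
  · intro r
    rw [Complex.volume_ball]
    congr 1
    exact NNReal.coe_real_pi ▸ (ENNReal.ofReal_coe_nnreal).symm
  · rw [← lintegral_const_mul _ h3]
    refine lintegral_congr fun t ↦ ?_
    rw [← mul_assoc, ← ENNReal.ofReal_mul Real.pi_pos.le, ← mul_assoc,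
      mul_inv_cancel₀ Real.pi_pos.ne', one_mul]

lemma stdComplexNormal_tail {T : ℝ} (hT : 0 ≤ T) :
    stdComplexNormal {z | T < ‖z‖ ^ 2} = ENNReal.ofReal (Real.exp (-T)) := by
  have h := lintegral_stdComplexNormal
    (f := (Set.Ioi T).indicator 1) (measurable_one.indicator measurableSet_Ioi)
  have h1 : ∀ z : ℂ, (Set.Ioi T).indicator (1 : ℝ → ℝ≥0∞) (‖z‖ ^ 2) =
      {z : ℂ | T < ‖z‖ ^ 2}.indicator 1 z := fun z ↦ rfl
  have hm : MeasurableSet {z : ℂ | T < ‖z‖ ^ 2} :=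
    measurableSet_lt measurable_const (by fun_prop)
  simp_rw [h1] at h
  rw [lintegral_indicator_one hm] at h
  rw [h]
  have h2 : ∀ t : ℝ, ENNReal.ofReal (Real.exp (-t)) * (Set.Ioi T).indicator 1 t =
      (Set.Ioi T).indicator (fun t ↦ ENNReal.ofReal (Real.exp (-t))) t := by
    intro t
    by_cases ht : t ∈ Set.Ioi T <;> simp [ht]
  simp_rw [h2]
  rw [lintegral_indicator measurableSet_Ioi, Measure.restrict_restrict measurableSet_Ioi,
    Set.inter_eq_left.2 (Set.Ioi_subset_Ioi hT), ← integral_exp_neg_Ioi,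
    ofReal_integral_eq_lintegral_ofReal (integrableOn_exp_neg_Ioi T)
      (.of_forall fun t ↦ (Real.exp_pos _).le)]

lemma lintegral_Gamma {s : ℝ} (hs : 0 < s) :
    ∫⁻ t in Set.Ioi (0 : ℝ), ENNReal.ofReal (Real.exp (-t)) * ENNReal.ofReal (t ^ (s - 1)) =
      ENNReal.ofReal (Real.Gamma s) := by
  rw [Real.Gamma_eq_integral hs, ofReal_integral_eq_lintegral_ofReal
    (Real.GammaIntegral_convergent hs)]
  · refine lintegral_congr fun t ↦ ?_
    rw [ENNReal.ofReal_mul (Real.exp_pos _).le]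
  · filter_upwards [ae_restrict_mem measurableSet_Ioi] with t ht
    have : (0 : ℝ) < t := ht
    positivity

lemma lintegral_enorm_rpow_stdComplexNormal {s : ℝ} (hs : 0 ≤ s) :
    ∫⁻ z, (‖z‖ₑ ^ 2) ^ s ∂stdComplexNormal = ENNReal.ofReal (Real.Gamma (1 + s)) := by
  have h := lintegral_stdComplexNormal (f := fun t ↦ ENNReal.ofReal (t ^ s)) (by fun_prop)
  have h1 : ∀ z : ℂ, (‖z‖ₑ ^ 2) ^ s = ENNReal.ofReal ((‖z‖ ^ 2) ^ s) := by
    intro z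
    rw [← ENNReal.ofReal_rpow_of_nonneg (by positivity) hs, ENNReal.ofReal_pow (norm_nonneg z),
      ofReal_norm]
  simp_rw [h1]
  rw [h, ← lintegral_Gamma (by linarith)]
  simp

lemma one_sub_expNeg_ofReal {w : ℝ} (hw : 0 ≤ w) :
    1 - expNeg (ENNReal.ofReal w) =
      ∫⁻ v in Set.Ioo 0 w, ENNReal.ofReal (Real.exp (-v)) := by
  rw [expNeg_ofReal hw, ← ofReal_integral_eq_lintegral_ofReal, ← integral_Ioc_eq_integral_Ioo,
    ← intervalIntegral.integral_of_le hw]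
  · simp only [intervalIntegral.integral_comp_neg, integral_exp, neg_zero, Real.exp_zero]
    rw [ENNReal.ofReal_sub _ (Real.exp_pos _).le, ENNReal.ofReal_one]
  · exact (by fun_prop : Continuous fun v : ℝ ↦ Real.exp (-v)).integrableOn_Icc.mono_set
      Set.Ioo_subset_Icc_self
  · exact .of_forall fun t ↦ (Real.exp_pos _).le

/-- The integral behind the Laplace transform of the interference with path loss. -/
lemma lintegral_Ioi_one_sub_expNeg {c s : ℝ} (hc : 0 ≤ c) (hs : 1 < s) :
    ∫⁻ t in Set.Ioi (0 : ℝ), (1 - expNeg (ENNReal.ofReal (c * t ^ (-s)))) =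
      ENNReal.ofReal (Real.Gamma (1 - s⁻¹)) * ENNReal.ofReal (c ^ s⁻¹) := by
  have hs0 : 0 < s := by linarith
  -- Layer cake: 1 - e^(-w) is the integral of e^(-v) over 0 < v < w. After swapping, the t-section
  -- of this region at v > 0 has length (c/v)^(1/s), which leaves the Gamma integral at 1 - 1/s; it
  -- converges because s > 1.
  let S : Set (ℝ × ℝ) := {z | 0 < z.1 ∧ 0 < z.2 ∧ z.2 < c * z.1 ^ (-s)}
  have hS : MeasurableSet S := by
    refine (measurableSet_lt measurable_const measurable_fst).inter
      ((measurableSet_lt measurable_const measurable_snd).inter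
        (measurableSet_lt measurable_snd ?_))
    fun_prop
  let G : ℝ → ℝ → ℝ≥0∞ := fun t v ↦ S.indicator (fun z ↦ ENNReal.ofReal (Real.exp (-z.2))) (t, v)
  have hG : Measurable (Function.uncurry G) :=
    (by fun_prop : Measurable fun z : ℝ × ℝ ↦ ENNReal.ofReal (Real.exp (-z.2))).indicator hS
  have h1 : ∀ t ∈ Set.Ioi (0 : ℝ), 1 - expNeg (ENNReal.ofReal (c * t ^ (-s))) =
      ∫⁻ v, G t v := by
    intro t ht
    have ht' : (0 : ℝ) < t := ht
    rw [one_sub_expNeg_ofReal (by positivity), ← lintegral_indicator measurableSet_Ioo]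
    refine lintegral_congr fun v ↦ ?_
    have : (t, v) ∈ S ↔ v ∈ Set.Ioo 0 (c * t ^ (-s)) := by simp [S, ht']
    by_cases hv : v ∈ Set.Ioo 0 (c * t ^ (-s))
    · simp only [G, Set.indicator_of_mem hv, Set.indicator_of_mem (this.2 hv)]
    · simp only [G, Set.indicator_of_notMem hv, Set.indicator_of_notMem (this.not.2 hv)]
  rw [setLIntegral_congr_fun measurableSet_Ioi h1, lintegral_lintegral_swap hG.aemeasurable,
    ← lintegral_Gamma (by simpa using inv_lt_one_of_one_lt₀ hs), ← lintegral_mul_const _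
      (by fun_prop), ← lintegral_indicator measurableSet_Ioi]
  refine lintegral_congr fun v ↦ ?_
  by_cases hv : 0 < v
  · have hset : ∀ t ∈ Set.Ioi (0 : ℝ), G t v = (Set.Iio (c ^ s⁻¹ * v ^ (-s⁻¹))).indicator
        (fun _ ↦ ENNReal.ofReal (Real.exp (-v))) t := by
      intro t ht
      have ht' : (0 : ℝ) < t := ht
      have hiff : (t, v) ∈ S ↔ t ∈ Set.Iio (c ^ s⁻¹ * v ^ (-s⁻¹)) := by
        simp only [S, Set.mem_ofPred_eq, ht', hv, true_and, Set.mem_Iio]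
        rw [Real.rpow_neg ht'.le, Real.rpow_neg hv.le, ← div_eq_mul_inv, ← div_eq_mul_inv,
          ← Real.div_rpow hc hv.le, Real.lt_rpow_inv_iff_of_pos ht'.le (by positivity) hs0,
          lt_div_iff₀ hv, lt_div_iff₀ (by positivity), mul_comm]
      by_cases htS : t ∈ Set.Iio (c ^ s⁻¹ * v ^ (-s⁻¹))
      · simp only [G, Set.indicator_of_mem htS, Set.indicator_of_mem (hiff.2 htS)]
      · simp only [G, Set.indicator_of_notMem htS, Set.indicator_of_notMem (hiff.not.2 htS)]
    rw [setLIntegral_congr_fun measurableSet_Ioi hset, lintegral_indicator measurableSet_Iio,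
      setLIntegral_const, Measure.restrict_apply measurableSet_Iio, Set.Iio_inter_Ioi,
      Real.volume_Ioo, sub_zero, Set.indicator_of_mem (Set.mem_Ioi.2 hv),
      ENNReal.ofReal_mul (by positivity), mul_comm (ENNReal.ofReal (c ^ s⁻¹)), ← mul_assoc]
    congr 4
    ring
  · have : ∀ t, G t v = 0 := fun t ↦ Set.indicator_of_notMem (fun h ↦ hv h.2.1) _
    simp [this, hv]

lemma lintegral_plane_one_sub_expNeg {α : ℝ} (hα : 2 < α) {c : ℝ≥0∞} (hc : c ≠ ∞) :
    ∫⁻ x : Plane, (1 - expNeg (c * ‖x‖ₑ ^ (-α))) =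
      ENNReal.ofReal (Real.pi * Real.Gamma (1 - 2 / α)) * c ^ (2 / α) := by
  lift c to ℝ≥0 using hc
  have hα0 : 0 < α := by linarith
  have h1 : ∀ x : Plane, x ≠ 0 → 1 - expNeg (c * ‖x‖ₑ ^ (-α)) =
      1 - expNeg (ENNReal.ofReal (c * (‖x‖ ^ 2) ^ (-(α / 2)))) := by
    intro x hx
    have hx' : 0 < ‖x‖ := norm_pos_iff.2 hx
    rw [ENNReal.ofReal_mul c.coe_nonneg, ENNReal.ofReal_coe_nnreal, ← ofReal_norm,
      ENNReal.ofReal_rpow_of_pos hx', ← Real.rpow_natCast, ← Real.rpow_mul hx'.le]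
    congr 5
    push_cast
    ring
  -- The origin is dropped because a negative power of 0 is ∞ in `ℝ≥0∞` but 0 in `ℝ`.
  have h2 : (fun x : Plane ↦ 1 - expNeg (c * ‖x‖ₑ ^ (-α))) =ᵐ[volume]
      fun x ↦ 1 - expNeg (ENNReal.ofReal (c * (‖x‖ ^ 2) ^ (-(α / 2)))) := by
    filter_upwards [compl_mem_ae_iff.2 (measure_singleton (0 : Plane))] with x hx
    exact h1 x hx
  have hf : Measurable fun t : ℝ ↦ 1 - expNeg (ENNReal.ofReal (c * t ^ (-(α / 2)))) :=
    measurable_const.sub (measurable_expNeg.comp (by fun_prop))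
  rw [lintegral_congr_ae h2, lintegral_norm_sq (EuclideanSpace.volume_ball_fin_two 0) hf,
    lintegral_Ioi_one_sub_expNeg c.coe_nonneg (by linarith), inv_div, ENNReal.ofReal_mul Real.pi_pos.le,
    mul_assoc, ← ENNReal.ofReal_rpow_of_nonneg c.coe_nonneg (by positivity)]
  simp

/-- Reconciles the non-strict SINR threshold with the strict tail `stdComplexNormal_tail`. At `T =
0` it also discards the fading value 0, where the SINR is 0/0 = 0. -/
lemma ae_norm_sq_ne_stdComplexNormal (T : ℝ) : ∀ᵐ z ∂stdComplexNormal, ‖z‖ ^ 2 ≠ T := by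
  have hm : Measurable (({T} : Set ℝ).indicator (1 : ℝ → ℝ≥0∞)) :=
    measurable_one.indicator (measurableSet_singleton T)
  have h := lintegral_stdComplexNormal hm
  have h0 : ∫⁻ t in Set.Ioi 0, ENNReal.ofReal (Real.exp (-t)) * ({T} : Set ℝ).indicator 1 t = 0 := by
    rw [lintegral_eq_zero_iff (by fun_prop)]
    refine ae_restrict_of_ae ?_
    filter_upwards [compl_mem_ae_iff.2 (measure_singleton T)] with t ht
    have : t ∉ ({T} : Set ℝ) := ht
    simp [Set.indicator_of_notMem this]
  rw [h0, lintegral_eq_zero_iff (by fun_prop)] at h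
  filter_upwards [h] with z hz hzT
  simp [hzT] at hz

/-- Conditional coverage probability given the interference `T`, under Rayleigh fading. -/
lemma stdComplexNormal_le_sinr {α d q β₀ : ℝ} (hd : 0 < d) (hq : 0 < q) (hβ₀ : 0 < β₀)
    (T : ℝ≥0∞) :
    stdComplexNormal {z | ENNReal.ofReal β₀ ≤
      (ENNReal.ofReal q * ‖z‖ₑ ^ 2 * ENNReal.ofReal d ^ (-α)) / T} =
      expNeg (ENNReal.ofReal (β₀ * d ^ α / q) * T) := by
  have hs : 0 < β₀ * d ^ α / q := by positivity
  induction T using ENNReal.recTopCoe with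
  | top =>
    rw [ENNReal.mul_top (by simpa using hs), expNeg_top]
    simp [hβ₀.not_ge]
  | coe t =>
    have ht0 : (0 : ℝ) ≤ t := t.coe_nonneg
    rw [← ENNReal.ofReal_coe_nnreal, ← ENNReal.ofReal_mul hs.le, expNeg_ofReal (by positivity),
      ← stdComplexNormal_tail (by positivity)]
    refine measure_congr ?_
    filter_upwards [ae_norm_sq_ne_stdComplexNormal (β₀ * d ^ α / q * t)] with z hz
    refine propext ?_
    change ENNReal.ofReal β₀ ≤ _ ↔ β₀ * d ^ α / q * t < ‖z‖ ^ 2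
    rw [← ofReal_norm, ← ENNReal.ofReal_pow (norm_nonneg z), ENNReal.ofReal_rpow_of_pos hd,
      ← ENNReal.ofReal_mul hq.le, ← ENNReal.ofReal_mul (by positivity)]
    rcases ht0.eq_or_lt with ht | ht
    · rw [← ht, mul_zero] at hz ⊢
      have hz' : 0 < ‖z‖ ^ 2 := lt_of_le_of_ne (by positivity) hz.symm
      have : 0 < q * ‖z‖ ^ 2 * d ^ (-α) := by positivity
      rw [ENNReal.ofReal_zero, ENNReal.div_zero (by simpa using this)]
      simpa using hz'
    · rw [ENNReal.le_div_iff_mul_le (Or.inl (by simpa using ht.ne')) (Or.inl ENNReal.ofReal_ne_top),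
        ← ENNReal.ofReal_mul hβ₀.le, ENNReal.ofReal_le_ofReal_iff (by positivity),
        Real.rpow_neg hd.le, ← div_eq_mul_inv, le_div_iff₀ (by positivity)]
      have e : β₀ * d ^ α / q * t < ‖z‖ ^ 2 ↔ β₀ * t * d ^ α < q * ‖z‖ ^ 2 := by
        rw [div_mul_eq_mul_div, div_lt_iff₀ hq, mul_comm (‖z‖ ^ 2), mul_right_comm]
      rw [e]
      refine ⟨fun hle ↦ lt_of_le_of_ne hle fun heq ↦ hz ?_, le_of_lt⟩
      field_simp
      linarith

@[fun_prop]
lemma measurable_interference (α : ℝ) :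
    Measurable fun z : Plane × ℝ × ℂ ↦ ENNReal.ofReal z.2.1 * ‖z.2.2‖ₑ ^ 2 * ‖z.1‖ₑ ^ (-α) := by
  fun_prop

lemma measurable_sinr (α σ2 d : ℝ) :
    Measurable fun z : ℝ × ℂ × (ℕ → Plane) × (ℕ → ℝ) × (ℕ → ℂ) ↦
      sinr α σ2 d z.1 z.2.1 z.2.2.1 z.2.2.2.1 z.2.2.2.2 := by
  refine Measurable.div (by fun_prop) (Measurable.add (Measurable.tsum fun k ↦ ?_) (by fun_prop))
  exact (measurable_interference α).comp
    (by fun_prop : Measurable fun z : ℝ × ℂ × (ℕ → Plane) × (ℕ → ℝ) × (ℕ → ℂ) ↦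
      (z.2.2.1 k, z.2.2.2.1 k, z.2.2.2.2 k))

/-- Euler's reflection formula, after Γ(1+s) = s Γ(s). -/
lemma Gamma_one_sub_mul_Gamma_one_add {s : ℝ} (hs : 0 < s) :
    Real.Gamma (1 - s) * Real.Gamma (1 + s) = (nsinc s)⁻¹ := by
  have hne : Real.pi * s ≠ 0 := by positivity
  rw [add_comm 1 s, Real.Gamma_add_one hs.ne', nsinc, Real.sinc_of_ne_zero hne, inv_div,
    mul_div_assoc, mul_comm, mul_assoc, Real.Gamma_mul_Gamma_one_sub]
  ring

lemma nsinc_pos {s : ℝ} (hs : 0 < s) (hs1 : s < 1) : 0 < nsinc s := by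
  rw [← inv_pos, ← Gamma_one_sub_mul_Gamma_one_add hs]
  exact mul_pos (Real.Gamma_pos_of_pos (by linarith)) (Real.Gamma_pos_of_pos (by linarith))

/-! ### Coverage probability of the network -/

section Network

variable {Ω : Type*} [MeasurableSpace Ω] {P : Measure Ω}
  {lam : ℝ} {F : Measure ℝ} {X : ℕ → Ω → Plane} {p : ℕ → Ω → ℝ}
  {h : ℕ → Ω → ℂ} {h₀ : Ω → ℂ}

lemma IsPoissonPointProcess.meanCount_eq (hX : IsPoissonPointProcess P lam X) (hlam : 0 ≤ lam)
    {R : ℝ} (hR : 0 ≤ R) : meanCount P X R = lam * (Real.pi * R ^ 2) := by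
  have hvol : volume (Metric.closedBall (0 : Plane) R) = ENNReal.ofReal (Real.pi * R ^ 2) := by
    rw [EuclideanSpace.volume_closedBall_fin_two, ← ENNReal.ofReal_pow hR,
      ← ENNReal.ofReal_mul (by positivity), mul_comm]
  have h1 := lintegral_map (μ := P) measurable_id
    (measurable_pointCount hX.measurable (measurableSet_closedBall (x := (0 : Plane)) (ε := R)))
  have h2 := hX.poisson _ (measurableSet_closedBall (x := (0 : Plane)) (ε := R))
    (by simp [hvol])
  rw [h2, lintegral_map measurable_id (by fun_prop)] at h1
  simp only [id] at h1
  rw [meanCount, ← h1, lintegral_natCast_poissonMeasure, hvol,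
    ENNReal.toReal_ofReal (by positivity)]
  simp only [ENNReal.coe_toReal]
  exact Real.coe_toNNReal _ (by positivity)

/-- Negative powers act as power 0 through `ENNReal.ofReal`, so φ is determined on the whole line.
-/
lemma coverage_const_of_nonpos {α d q β₀ : ℝ} (hq : q ≤ 0) (hβ₀ : 0 < β₀) :
    coverage P X p h h₀ α 0 β₀ d (fun _ ↦ q) = 0 := by
  simp [coverage, sinr, ENNReal.ofReal_of_nonpos hq, hβ₀.not_ge]

variable [IsProbabilityMeasure P]

/-- Integrating out `h₀` given everything else leaves the Laplace transform of the interference at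
β₀ d^α / q. -/
lemma IsUplinkNetwork.measure_le_sinr (hnet : IsUplinkNetwork P lam F X p h h₀)
    {α d q β₀ : ℝ} (hd : 0 < d) (hq : 0 < q) (hβ₀ : 0 < β₀) :
    P {ω | ENNReal.ofReal β₀ ≤
      sinr α 0 d q (h₀ ω) (fun k ↦ X k ω) (fun k ↦ p k ω) (fun k ↦ h k ω)} =
    ∫⁻ ω, expNeg (∑' k, ENNReal.ofReal (β₀ * d ^ α / q) *
      (ENNReal.ofReal (p k ω) * ‖h k ω‖ₑ ^ 2 * ‖X k ω‖ₑ ^ (-α))) ∂P := by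
  have hU : Measurable fun ω ↦ ((fun k ↦ X k ω), (fun k ↦ p k ω), (fun k ↦ h k ω)) :=
    (measurable_pi_lambda _ hnet.ppp.measurable).prodMk
      ((measurable_pi_lambda _ hnet.measurable_power).prodMk
        (measurable_pi_lambda _ hnet.measurable_fading))
  have hS : MeasurableSet {z : ((ℕ → Plane) × (ℕ → ℝ) × (ℕ → ℂ)) × ℂ |
      ENNReal.ofReal β₀ ≤ sinr α 0 d q z.2 z.1.1 z.1.2.1 z.1.2.2} :=
    measurableSet_le measurable_const ((measurable_sinr α 0 d).comp
      (by fun_prop : Measurable fun z : ((ℕ → Plane) × (ℕ → ℝ) × (ℕ → ℂ)) × ℂ ↦ (q, z.2, z.1)))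
  refine (measure_of_indepFun hU hnet.measurable_uplink hnet.indep_uplink hS).trans
    (lintegral_congr fun ω ↦ ?_)
  rw [ENNReal.tsum_mul_left, ← stdComplexNormal_le_sinr hd hq hβ₀, ← hnet.law_uplink,
    Measure.map_apply hnet.measurable_uplink]
  · simp [sinr]
  · exact measurableSet_le measurable_const (by fun_prop)

/-- Coverage probability for a fixed positive uplink power. -/
theorem IsUplinkNetwork.coverage_const (hnet : IsUplinkNetwork P lam F X p h h₀)
    {α d q β₀ R : ℝ} (hα : 2 < α) (hlam : 0 < lam) (hR : 0 < R) (hd : 0 < d) (hq : 0 < q)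
    (hβ₀ : 0 < β₀) (hF : ∀ᵐ q ∂F, 0 ≤ q) (hFint : Integrable (fun q : ℝ ↦ q ^ (2 / α)) F) :
    coverage P X p h h₀ α 0 β₀ d (fun _ ↦ q) =
      Real.exp (-(meanCount P X R * β₀ ^ (2 / α) / nsinc (2 / α) * powerMoment α F * (d / R) ^ 2 *
        q ^ (-(2 / α)))) := by
  have hα0 : 0 < α := by linarith
  have hδ : 0 < 2 / α := by positivity
  have hδ1 : 2 / α < 1 := by rwa [div_lt_one hα0]
  have hM : 0 ≤ powerMoment α F :=
    integral_nonneg_of_ae (hF.mono fun q hq ↦ Real.rpow_nonneg hq _)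
  have hns := nsinc_pos hδ hδ1
  set s : ℝ := β₀ * d ^ α / q with hs
  have hs0 : 0 < s := by positivity
  have hMlin : ∫⁻ r, ENNReal.ofReal r ^ (2 / α) ∂F = ENNReal.ofReal (powerMoment α F) := by
    rw [powerMoment, ofReal_integral_eq_lintegral_ofReal hFint
      (hF.mono fun q hq ↦ Real.rpow_nonneg hq _)]
    refine lintegral_congr_ae (hF.mono fun r hr ↦ ?_)
    exact ENNReal.ofReal_rpow_of_nonneg hr hδ.le
  have hint : ∫⁻ r, ∫⁻ g, ∫⁻ x : Plane, (1 - expNeg (ENNReal.ofReal s *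
      (ENNReal.ofReal r * ‖g‖ₑ ^ 2 * ‖x‖ₑ ^ (-α)))) ∂volume ∂stdComplexNormal ∂F =
      ENNReal.ofReal (Real.pi * Real.Gamma (1 - 2 / α)) * (ENNReal.ofReal s ^ (2 / α) *
        (ENNReal.ofReal (powerMoment α F) * ENNReal.ofReal (Real.Gamma (1 + 2 / α)))) := by
    have h1 : ∀ (r : ℝ) (g : ℂ), ∫⁻ x : Plane, (1 - expNeg (ENNReal.ofReal s *
        (ENNReal.ofReal r * ‖g‖ₑ ^ 2 * ‖x‖ₑ ^ (-α)))) =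
        ENNReal.ofReal (Real.pi * Real.Gamma (1 - 2 / α)) * (ENNReal.ofReal s ^ (2 / α) *
        (ENNReal.ofReal r ^ (2 / α) * (‖g‖ₑ ^ 2) ^ (2 / α))) := by
      intro r g
      rw [← ENNReal.mul_rpow_of_nonneg _ _ hδ.le, ← ENNReal.mul_rpow_of_nonneg _ _ hδ.le,
        ← lintegral_plane_one_sub_expNeg hα]
      · simp only [mul_assoc]
      · exact ENNReal.mul_ne_top ENNReal.ofReal_ne_top
          (ENNReal.mul_ne_top ENNReal.ofReal_ne_top (by simp))
    simp_rw [h1]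
    have h2 : ∀ r : ℝ, ∫⁻ g, ENNReal.ofReal (Real.pi * Real.Gamma (1 - 2 / α)) *
        (ENNReal.ofReal s ^ (2 / α) * (ENNReal.ofReal r ^ (2 / α) * (‖g‖ₑ ^ 2) ^ (2 / α)))
          ∂stdComplexNormal = ENNReal.ofReal (Real.pi * Real.Gamma (1 - 2 / α)) *
        (ENNReal.ofReal s ^ (2 / α) * (ENNReal.ofReal r ^ (2 / α) *
          ENNReal.ofReal (Real.Gamma (1 + 2 / α)))) := by
      intro r
      rw [lintegral_const_mul _ (by fun_prop), lintegral_const_mul _ (by fun_prop),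
        lintegral_const_mul _ (by fun_prop), lintegral_enorm_rpow_stdComplexNormal hδ.le]
    simp_rw [h2]
    rw [lintegral_const_mul _ (by fun_prop), lintegral_const_mul _ (by fun_prop),
        lintegral_mul_const _ (by fun_prop), hMlin]
  have hΓ1 : 0 < Real.Gamma (1 - 2 / α) := Real.Gamma_pos_of_pos (by linarith)
  have hΓ2 : 0 < Real.Gamma (1 + 2 / α) := Real.Gamma_pos_of_pos (by linarith)
  have hπ := Real.pi_pos
  rw [coverage, measureReal_def, hnet.measure_le_sinr hd hq hβ₀, hnet.laplace
    (J := fun x r g ↦ ENNReal.ofReal s * (ENNReal.ofReal r * ‖g‖ₑ ^ 2 * ‖x‖ₑ ^ (-α))) hlam.le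
    ((measurable_interference α).const_mul _), hint, ENNReal.ofReal_rpow_of_pos hs0,
    ← ENNReal.ofReal_mul hM, ← ENNReal.ofReal_mul (by positivity),
    ← ENNReal.ofReal_mul (by positivity), ← ENNReal.ofReal_mul (by positivity),
    expNeg_ofReal (by positivity), ENNReal.toReal_ofReal (Real.exp_pos _).le,
    hnet.ppp.meanCount_eq hlam.le hR.le]
  congr 2
  have hsδ : s ^ (2 / α) = β₀ ^ (2 / α) * d ^ 2 * q ^ (-(2 / α)) := by
    rw [hs, Real.div_rpow (by positivity) hq.le, Real.mul_rpow hβ₀.le (by positivity),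
      ← Real.rpow_mul hd.le, Real.rpow_neg hq.le, mul_div_cancel₀ _ hα0.ne', div_eq_mul_inv]
    norm_num
  have hG := Gamma_one_sub_mul_Gamma_one_add hδ
  -- The cell radius is only a normalization: E[K] (d/R)² = λπd².
  calc lam * (Real.pi * Real.Gamma (1 - 2 / α) * (s ^ (2 / α) * (powerMoment α F *
        Real.Gamma (1 + 2 / α))))
      = lam * Real.pi * s ^ (2 / α) * powerMoment α F *
        (Real.Gamma (1 - 2 / α) * Real.Gamma (1 + 2 / α)) := by ring
    _ = _ := by
      rw [hG, hsδ]
      field_simp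

/-- The coverage probability under a random uplink power averages the coverage probabilities
under fixed powers. -/
lemma IsUplinkNetwork.coverage_random (hnet : IsUplinkNetwork P lam F X p h h₀)
    {α σ2 d β₀ : ℝ} {p₀ : Ω → ℝ} (hp₀ : Measurable p₀)
    (hind : IndepFun p₀
      (fun ω ↦ (h₀ ω, (fun k ↦ X k ω), (fun k ↦ p k ω), (fun k ↦ h k ω))) P)
    {φ : ℝ → ℝ} (hφm : Measurable φ)
    (hφ : ∀ q, φ q = coverage P X p h h₀ α σ2 β₀ d (fun _ ↦ q)) :
    coverage P X p h h₀ α σ2 β₀ d p₀ = ∫ q, φ q ∂(P.map p₀) := by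
  have hW : Measurable fun ω ↦ (h₀ ω, (fun k ↦ X k ω), (fun k ↦ p k ω), (fun k ↦ h k ω)) :=
    hnet.measurable_uplink.prodMk ((measurable_pi_lambda _ hnet.ppp.measurable).prodMk
      ((measurable_pi_lambda _ hnet.measurable_power).prodMk
        (measurable_pi_lambda _ hnet.measurable_fading)))
  have hS := measurableSet_le (measurable_const (a := ENNReal.ofReal β₀)) (measurable_sinr α σ2 d)
  have key := measure_of_indepFun hp₀ hW hind hS
  have h0 : ∀ q, 0 ≤ φ q := fun q ↦ by rw [hφ]; exact measureReal_nonneg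
  rw [integral_map hp₀.aemeasurable hφm.aestronglyMeasurable,
    integral_eq_lintegral_of_nonneg_ae (.of_forall fun ω ↦ h0 _)
      (hφm.comp hp₀).aestronglyMeasurable, coverage, measureReal_def]
  congr 1
  refine key.trans (lintegral_congr fun ω ↦ ?_)
  rw [hφ, coverage, measureReal_def, ENNReal.ofReal_toReal (measure_ne_top _ _)]
  rfl

end Network

/-! ### Affine majorants of the coverage profile -/

/-- Coverage profile `q ↦ exp (-c q ^ (-δ))` as a function of the transmit power. -/
noncomputable def coverageProfile (c δ q : ℝ) : ℝ :=
  if 0 < q then Real.exp (-(c * q ^ (-δ))) else 0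

lemma coverageProfile_of_pos {c δ q : ℝ} (hq : 0 < q) :
    coverageProfile c δ q = Real.exp (-(c * q ^ (-δ))) := if_pos hq

lemma coverageProfile_of_nonpos {c δ q : ℝ} (hq : q ≤ 0) : coverageProfile c δ q = 0 :=
  if_neg hq.not_gt

lemma coverageProfile_nonneg (c δ q : ℝ) : 0 ≤ coverageProfile c δ q := by
  unfold coverageProfile
  split_ifs <;> positivity

lemma coverageProfile_le_one {c : ℝ} (hc : 0 ≤ c) (δ q : ℝ) : coverageProfile c δ q ≤ 1 := by
  unfold coverageProfile
  split_ifs with h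
  · rw [Real.exp_le_one_iff, neg_nonpos]
    positivity
  · exact zero_le_one

lemma measurable_coverageProfile (c δ : ℝ) : Measurable (coverageProfile c δ) :=
  Measurable.ite measurableSet_Ioi (by fun_prop) measurable_const

lemma one_sub_rpow_neg_le {t : ℝ} (ht : 0 < t) (δ : ℝ) : 1 - t ^ (-δ) ≤ δ * Real.log t := by
  have := Real.log_le_sub_one_of_pos (Real.rpow_pos_of_pos ht (-δ))
  rw [Real.log_rpow ht] at this
  linarith

/-- Rescaling of the coverage profile around a reference power `r`. -/
lemma coverageProfile_eq_mul {c δ q r : ℝ} (hq : 0 < q) (hr : 0 < r) :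
    coverageProfile c δ q =
      coverageProfile c δ r * Real.exp (c * r ^ (-δ) * (1 - (q / r) ^ (-δ))) := by
  rw [coverageProfile_of_pos hq, coverageProfile_of_pos hr, ← Real.exp_add,
    Real.div_rpow hq.le hr.le]
  have := (Real.rpow_pos_of_pos hr (-δ)).ne'
  congr 1
  field_simp
  ring

/-- If `r` is at least the reference power, the tangent at `r` dominates the coverage profile. -/
lemma coverageProfile_le_tangent {c δ q r : ℝ} (hc : 0 ≤ c) (hδ : 0 < δ) (hq : 0 ≤ q) (hr : 0 < r)
    (h : c * r ^ (-δ) * δ ≤ 1) :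
    coverageProfile c δ q ≤
      coverageProfile c δ r * (1 + c * r ^ (-δ) * δ * (q / r - 1)) := by
  set a := c * r ^ (-δ) with ha
  have ha0 : 0 ≤ a := by positivity
  have hf := coverageProfile_nonneg c δ r
  rcases hq.eq_or_lt with rfl | hq
  · rw [coverageProfile_of_nonpos le_rfl]
    refine mul_nonneg hf ?_
    rw [zero_div]
    linarith
  · rw [coverageProfile_eq_mul hq hr]
    refine mul_le_mul_of_nonneg_left ?_ hf
    have ht : 0 < q / r := by positivity
    -- With t = q/r this compares with the power t^(aδ); since 0 ≤ aδ ≤ 1, Bernoulli's inequality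
    -- for concave powers applies.
    calc Real.exp (a * (1 - (q / r) ^ (-δ)))
        ≤ Real.exp (a * (δ * Real.log (q / r))) :=
          Real.exp_le_exp.2 (mul_le_mul_of_nonneg_left (one_sub_rpow_neg_le ht δ) ha0)
      _ = (1 + (q / r - 1)) ^ (a * δ) := by
          rw [add_sub_cancel, Real.rpow_def_of_pos ht]
          ring_nf
      _ ≤ 1 + a * δ * (q / r - 1) :=
          rpow_one_add_le_one_add_mul_self (by linarith) (by positivity) h

/-- If `r` is at most the reference power, the chord from `0` to `r` dominates the coverage profile
on `[0, r]`. -/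
lemma coverageProfile_le_chord {c δ q r : ℝ} (hδ : 0 < δ) (hq : 0 ≤ q) (hqr : q ≤ r) (hr : 0 < r)
    (h : 1 ≤ c * r ^ (-δ) * δ) :
    coverageProfile c δ q ≤ coverageProfile c δ r / r * q := by
  have hf := coverageProfile_nonneg c δ r
  rcases hq.eq_or_lt with rfl | hq
  · simp [coverageProfile_of_nonpos le_rfl]
  · rw [coverageProfile_eq_mul hq hr, div_mul_eq_mul_div, mul_div_assoc]
    refine mul_le_mul_of_nonneg_left ?_ hf
    have ht : 0 < q / r := by positivity
    have ht1 : q / r ≤ 1 := (div_le_one hr).2 hqr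
    rw [← Real.le_log_iff_exp_le ht]
    have h1 := one_sub_rpow_neg_le ht δ
    have h2 : 1 - (q / r) ^ (-δ) ≤ 0 := by
      have := Real.one_le_rpow_of_pos_of_le_one_of_nonpos ht ht1 (neg_nonpos.2 hδ.le)
      linarith
    -- As 1 - t^(-δ) ≤ 0 for t = q/r, multiplying it by cδ r^(-δ) ≥ 1 only decreases it.
    have h3 : δ * (c * r ^ (-δ) * (1 - (q / r) ^ (-δ))) ≤ δ * Real.log (q / r) := by nlinarith
    exact le_of_mul_le_mul_left h3 hδ

/-- An affine function dominates the coverage profile on `[0, Pmax]` and takes at `Pavg` the value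
achieved by on-off power control. -/
lemma exists_affine_bound {c δ Pavg Pmax pt : ℝ} (hc : 0 ≤ c) (hδ : 0 < δ) (hPavg : 0 < Pavg)
    (hPmax : Pavg ≤ Pmax) (hpt0 : 0 ≤ pt) (hpt : pt ^ δ = c * δ) :
    ∃ A B : ℝ, (∀ q, 0 ≤ q → q ≤ Pmax → coverageProfile c δ q ≤ A + B * q) ∧
      A + B * Pavg = Pavg / max (min pt Pmax) Pavg *
        coverageProfile c δ (max (min pt Pmax) Pavg) := by
  -- The logarithmic slope rφ'(r)/φ(r) equals (p̃₀/r)^δ, so comparing it with 1 is comparing r with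
  -- p̃₀.
  have hratio : ∀ r, 0 < r → c * r ^ (-δ) * δ = (pt / r) ^ δ := by
    intro r hr
    rw [Real.div_rpow hpt0 hr.le, hpt, Real.rpow_neg hr.le]
    ring
  rcases le_or_gt pt Pavg with h | h
  · have hm : max (min pt Pmax) Pavg = Pavg := max_eq_right ((min_le_left _ _).trans h)
    have h1 : c * Pavg ^ (-δ) * δ ≤ 1 := by
      rw [hratio _ hPavg]
      exact Real.rpow_le_one (by positivity) ((div_le_one hPavg).2 h) hδ.le
    refine ⟨coverageProfile c δ Pavg * (1 - c * Pavg ^ (-δ) * δ),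
      coverageProfile c δ Pavg * (c * Pavg ^ (-δ) * δ) / Pavg, fun q hq _ ↦ ?_, ?_⟩
    · refine (coverageProfile_le_tangent hc hδ hq hPavg h1).trans_eq ?_
      field_simp
      ring
    · rw [hm]
      field_simp
      ring
  · have hpt' : 0 < pt := hPavg.trans h
    rcases le_or_gt Pmax pt with h' | h'
    · have hm : max (min pt Pmax) Pavg = Pmax := by
        rw [min_eq_right h', max_eq_left hPmax]
      have hP : 0 < Pmax := hPavg.trans_le hPmax
      refine ⟨0, coverageProfile c δ Pmax / Pmax, fun q hq hqP ↦ ?_, ?_⟩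
      · rw [zero_add]
        refine coverageProfile_le_chord hδ hq hqP hP ?_
        rw [hratio _ hP]
        exact Real.one_le_rpow ((one_le_div hP).2 h') hδ.le
      · rw [hm]
        ring
    · have hm : max (min pt Pmax) Pavg = pt := by
        rw [min_eq_left h'.le, max_eq_left h.le]
      have h1 : c * pt ^ (-δ) * δ = 1 := by
        rw [hratio _ hpt', div_self hpt'.ne', Real.one_rpow]
      -- At p̃₀ the logarithmic slope is 1, so the tangent has no constant term.
      refine ⟨0, coverageProfile c δ pt / pt, fun q hq _ ↦ ?_, ?_⟩
      · refine (coverageProfile_le_tangent hc hδ hq hpt' h1.le).trans_eq ?_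
        rw [h1]
        field_simp
        ring
      · rw [hm]
        ring

/-! ### On-off laws and the dual bound -/

section OnOff

variable {Pavg q : ℝ}

lemma isFeasible_onOffLaw {Pmax : ℝ} (hPavg : 0 < Pavg) (hq : Pavg ≤ q) (hqP : q ≤ Pmax) :
    IsFeasible Pavg Pmax (onOffLaw Pavg q) := by
  have hq0 : 0 < q := hPavg.trans_le hq
  have h1 : Pavg / q ≤ 1 := (div_le_one hq0).2 hq
  refine ⟨⟨?_⟩, ?_, ?_⟩
  · simp only [onOffLaw, Measure.add_apply, Measure.smul_apply, measure_univ, smul_eq_mul, mul_one]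
    rw [← ENNReal.ofReal_add (by positivity) (by linarith)]
    simp
  · rw [onOffLaw, ae_add_measure_iff]
    constructor
    · refine Measure.ae_smul_measure ?_ _
      rw [ae_dirac_eq]
      exact ⟨hq0.le, hqP⟩
    · refine Measure.ae_smul_measure ?_ _
      rw [ae_dirac_eq]
      exact ⟨le_rfl, hq0.le.trans hqP⟩
  · rw [onOffLaw, integral_add_measure, integral_smul_measure, integral_smul_measure,
      integral_dirac, integral_dirac, ENNReal.toReal_ofReal (by positivity)]
    · simp [hq0.ne']
    · exact (integrable_dirac (by simp)).smul_measure ENNReal.ofReal_ne_top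
    · exact (integrable_dirac (by simp)).smul_measure ENNReal.ofReal_ne_top

lemma integral_onOffLaw (hPavg : 0 ≤ Pavg) (hq : 0 < q) {φ : ℝ → ℝ} (hφ0 : φ 0 = 0) :
    ∫ r, φ r ∂(onOffLaw Pavg q) = Pavg / q * φ q := by
  rw [onOffLaw, integral_add_measure, integral_smul_measure, integral_smul_measure,
    integral_dirac, integral_dirac, ENNReal.toReal_ofReal (by positivity)]
  · simp [hφ0]
  · exact (integrable_dirac (by simp)).smul_measure ENNReal.ofReal_ne_top
  · exact (integrable_dirac (by simp)).smul_measure ENNReal.ofReal_ne_top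

end OnOff

lemma IsFeasible.integral_le {Pavg Pmax : ℝ} {ν : Measure ℝ} (hν : IsFeasible Pavg Pmax ν)
    {φ : ℝ → ℝ} (hφ : Measurable φ) (hφ0 : ∀ q, 0 ≤ φ q) (hφ1 : ∀ q, φ q ≤ 1) {A B : ℝ}
    (hAB : ∀ q, 0 ≤ q → q ≤ Pmax → φ q ≤ A + B * q) : ∫ q, φ q ∂ν ≤ A + B * Pavg := by
  have := hν.prob
  have hid : Integrable (fun q : ℝ ↦ q) ν := by
    refine Integrable.of_bound measurable_id.aestronglyMeasurable Pmax
      (hν.peak.mono fun q hq ↦ ?_)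
    rw [Real.norm_of_nonneg hq.1]
    exact hq.2
  have hint : Integrable φ ν := by
    refine Integrable.of_bound hφ.aestronglyMeasurable 1 (.of_forall fun q ↦ ?_)
    rw [Real.norm_of_nonneg (hφ0 q)]
    exact hφ1 q
  calc ∫ q, φ q ∂ν ≤ ∫ q, (A + B * q) ∂ν :=
        integral_mono_ae hint ((integrable_const A).add (hid.const_mul B))
          (hν.peak.mono fun q hq ↦ hAB q hq.1 hq.2)
    _ = A + B * Pavg := by
        rw [integral_add (integrable_const A) (hid.const_mul B), integral_const_mul, hν.average]
        simp

/-- Identifies p̃₀ as the solution of p̃₀^δ = cδ, the only property the optimization uses. -/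
lemma rpow_pTilde {α β₀ R EK M d : ℝ} (hα : 2 < α) (hβ₀ : 0 ≤ β₀) (hR : 0 < R) (hd : 0 < d)
    (hEK : 0 ≤ EK) (hM : 0 ≤ M) :
    0 ≤ pTilde α β₀ R EK M d ∧ pTilde α β₀ R EK M d ^ (2 / α) =
      EK * β₀ ^ (2 / α) / nsinc (2 / α) * M * (d / R) ^ 2 * (2 / α) := by
  have hα0 : 0 < α := by linarith
  have hns := nsinc_pos (s := 2 / α) (by positivity) (by rwa [div_lt_one hα0])
  have hinv : α / 2 * (2 / α) = 1 := by field_simp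
  unfold pTilde
  refine ⟨by positivity, ?_⟩
  rw [Real.mul_rpow (by positivity) (by positivity), Real.mul_rpow (by positivity) hβ₀,
    Real.mul_rpow (by positivity) (by positivity), ← Real.rpow_mul (by positivity),
    ← Real.rpow_mul hEK, ← Real.rpow_mul (by positivity : 0 ≤ d / R), hinv,
    mul_div_cancel₀ _ hα0.ne', Real.rpow_one, Real.rpow_one, Real.rpow_two]
  field_simp

end D2D

/-! ### The theorem -/

theorem mainTheorem6 {Ω : Type*} [MeasurableSpace Ω] (P : Measure Ω) [IsProbabilityMeasure P]
    (α lam R β₀ d Pavg Pmax : ℝ) (hα : 2 < α) (hlam : 0 < lam) (hR : 0 < R) (hβ₀ : 0 < β₀)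
    (hd : 0 < d) (hPavg : 0 < Pavg) (hPmax : Pavg ≤ Pmax)
    (F : Measure ℝ) (hF : ∀ᵐ q ∂F, 0 ≤ q) (hFint : Integrable (fun q : ℝ => q ^ (2 / α)) F)
    (X : ℕ → Ω → D2D.Plane) (p : ℕ → Ω → ℝ) (h : ℕ → Ω → ℂ) (h₀ : Ω → ℂ)
    (hnet : D2D.IsUplinkNetwork P lam F X p h h₀)
    (EK M pt : ℝ) (hEK : EK = D2D.meanCount P X R) (hM : M = D2D.powerMoment α F)
    (hpt : pt = D2D.pTilde α β₀ R EK M d)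
    (φ : ℝ → ℝ) (hφ : ∀ q, φ q = D2D.coverage P X p h h₀ α 0 β₀ d (fun _ => q)) :
    -- on-off control at level `max (min p̃₀ Pmax) Pavg` is an optimal uplink power control
    D2D.IsOptimalLaw Pavg Pmax φ (D2D.onOffLaw Pavg (max (min pt Pmax) Pavg)) ∧
    -- the coverage probability under (any) optimal uplink power control
    ∀ p₀ : Ω → ℝ, Measurable p₀ →
      IndepFun p₀ (fun ω => (h₀ ω, (fun k => X k ω), (fun k => p k ω), (fun k => h k ω))) P →
      D2D.IsOptimalLaw Pavg Pmax φ (P.map p₀) →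
      (Pmax ≤ pt →
        D2D.coverage P X p h h₀ α 0 β₀ d p₀ =
          Pavg / Pmax * Real.exp (-(EK * β₀ ^ (2 / α) / D2D.nsinc (2 / α) * M * (d / R) ^ 2 *
            Pmax ^ (-2 / α)))) ∧
      (Pavg < pt → pt < Pmax →
        D2D.coverage P X p h h₀ α 0 β₀ d p₀ =
          Pavg * Real.exp (-(α / 2)) /
            ((2 * M / (α * D2D.nsinc (2 / α))) ^ (α / 2) * EK ^ (α / 2) * β₀ * (d / R) ^ α)) ∧
      (pt ≤ Pavg →
        D2D.coverage P X p h h₀ α 0 β₀ d p₀ =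
          Real.exp (-(EK * β₀ ^ (2 / α) / D2D.nsinc (2 / α) * M * (d / R) ^ 2 *
            Pavg ^ (-2 / α)))) := by
  have hα0 : 0 < α := by linarith
  have hδ : 0 < 2 / α := by positivity
  have hM0 : 0 ≤ M := hM ▸ integral_nonneg_of_ae (hF.mono fun q hq ↦ Real.rpow_nonneg hq _)
  have hEK0 : 0 ≤ EK := hEK ▸ ENNReal.toReal_nonneg
  have hns := D2D.nsinc_pos hδ (by rwa [div_lt_one hα0])
  set c : ℝ := EK * β₀ ^ (2 / α) / D2D.nsinc (2 / α) * M * (d / R) ^ 2 with hc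
  have hc0 : 0 ≤ c := by positivity
  have hφc : φ = D2D.coverageProfile c (2 / α) := by
    funext q
    rw [hφ]
    rcases le_or_gt q 0 with hq | hq
    · rw [D2D.coverage_const_of_nonpos hq hβ₀, D2D.coverageProfile_of_nonpos hq]
    · rw [hnet.coverage_const hα hlam hR hd hq hβ₀ hF hFint, D2D.coverageProfile_of_pos hq,
        hc, hEK, hM]
  obtain ⟨hpt0, hptδ⟩ := D2D.rpow_pTilde hα hβ₀.le hR hd hEK0 hM0
  rw [← hpt] at hpt0 hptδ
  rw [← hc] at hptδ
  obtain ⟨A, B, hAB, hval⟩ := D2D.exists_affine_bound hc0 hδ hPavg hPmax hpt0 hptδ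
  have hm1 : Pavg ≤ max (min pt Pmax) Pavg := le_max_right _ _
  have hm2 : max (min pt Pmax) Pavg ≤ Pmax := max_le (min_le_right _ _) hPmax
  have hφm : Measurable φ := hφc ▸ D2D.measurable_coverageProfile c _
  have hub : ∀ ν, D2D.IsFeasible Pavg Pmax ν → ∫ q, φ q ∂ν ≤ A + B * Pavg := fun ν hν ↦
    hν.integral_le hφm (fun q ↦ hφc ▸ D2D.coverageProfile_nonneg c _ q)
      (fun q ↦ hφc ▸ D2D.coverageProfile_le_one hc0 _ q) (hφc ▸ hAB)
  have hfeas := D2D.isFeasible_onOffLaw hPavg hm1 hm2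
  have honoff : ∫ q, φ q ∂(D2D.onOffLaw Pavg (max (min pt Pmax) Pavg)) = A + B * Pavg := by
    rw [D2D.integral_onOffLaw hPavg.le (hPavg.trans_le hm1)
      (hφc ▸ D2D.coverageProfile_of_nonpos le_rfl), hval, hφc]
  refine ⟨⟨hfeas, fun ν hν ↦ (hub ν hν).trans_eq honoff.symm⟩, fun p₀ hp₀ hind hopt ↦ ?_⟩
  -- An optimal law is bounded above by the affine majorant and below by the on-off law, so its
  -- value is forced without knowing the law.
  have hcov : D2D.coverage P X p h h₀ α 0 β₀ d p₀ = Pavg / max (min pt Pmax) Pavg *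
      D2D.coverageProfile c (2 / α) (max (min pt Pmax) Pavg) := by
    rw [hnet.coverage_random hp₀ hind hφm hφ, ← hval]
    exact le_antisymm (hub _ hopt.feasible) (honoff ▸ hopt.optimal _ hfeas)
  rw [D2D.coverageProfile_of_pos (hPavg.trans_le hm1)] at hcov
  rw [hcov, neg_div]
  refine ⟨fun h1 ↦ ?_, fun h1 h2 ↦ ?_, fun h1 ↦ ?_⟩
  · rw [min_eq_right h1, max_eq_left hPmax]
  · have hpt' : 0 < pt := hPavg.trans h1
    -- At p̃₀ the exponent c p̃₀^(-δ) is 1/δ, whence the factor exp(-α/2).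
    have hexp : c * pt ^ (-(2 / α)) = α / 2 := by
      rw [Real.rpow_neg hpt0, ← div_eq_mul_inv, div_eq_iff (Real.rpow_pos_of_pos hpt' _).ne', hptδ]
      field_simp
    rw [min_eq_left h2.le, max_eq_left h1.le, hexp, div_mul_eq_mul_div, hpt, D2D.pTilde]
  · rw [max_eq_right ((min_le_left _ _).trans h1), div_self hPavg.ne', one_mul]
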